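/- A count law is a probability distribution on $\{0,1,2,\dots\}$. For $p\in(0,1]$, the independent $p$-thinning (binomial subsampling) of a count random variable $X$ is $X_p=\zeta_1+\dots+\zeta_X$ ($X_p=0$ if $X=0$), where the $\zeta_i$ are i.i.d. Bernoulli($p$) and independent of $X$. A count random variable is a *top inverse* if its law is not that of a $p$-thinning of any count random variable for any $p\in(0,1)$. It is *mixed Poisson* if for some probability measure $\Lambda$ on $[0,\infty)$, $P(X=k)=\int e^{-\lambda}\lambda^k/k!\,d\Lambda(\lambda)$ for all $k$. Let $m\ge 0$ and let $\mathcal F$ be a family of count laws indexed by $\theta=(\mu,\xi)\in\Theta\subseteq\mathbb R\times\mathbb R^m$, whose probability generating function $\Phi(t;\theta)$ is continuous on $(0,1)\times\Theta$, and such that 1. $\mu$ is the population mean, finite and positive, of the law with parameter $(\mu,\xi)$; 2. $\xi$ is invariant under thinning: if the law with parameter $\theta'\in\Theta$ is a $p$-thinning, $p\in(0,1]$, of the law with parameter $\theta\in\Theta$, then $\theta'$ and $\theta$ have the same $\xi$; 3. $\mathcal F$ is closed under binomial subsampling: for every $p\in(0,1]$, every $p$-thinning of a member of $\mathcal F$ is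 a member of $\mathcal F$; 4. $\Theta$ is the widest possible: there is no family with a domain $\Theta^*\supsetneq\Theta$ that coincides with $\mathcal F$ on $\Theta$, has a probability generating function continuous on $(0,1)\times\Theta^*$, satisfies 1–3, and contains only values of $\xi$ that occur in $\Theta$. Then for every random variable $X$ with law in $\mathcal F$ exactly one of the following holds: (i) $X$ is mixed Poisson; (ii) $X$ has the law of an independent $p$-thinning, for some $p\in(0,1]$, of a top inverse $Y$ whose law belongs to $\mathcal F$. -/

import Mathlib

open Set

/-- Law of `ξ₁ + ⋯ + ξₙ`, where `ξ₁, …, ξₙ` are independent Bernoulli variables with probability of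
success `p`. -/
noncomputable def bernoulliSum (p : unitInterval) : ℕ → PMF ℕ
  | 0 => PMF.pure 0
  | n + 1 => (bernoulliSum p n).bind fun s =>
      ((ProbabilityTheory.bernoulliMeasure (1 : ℕ) 0 p).toPMF).map fun b => s + b

/-- Law of the independent `p`-thinning `ξ₁ + ⋯ + ξ_X` of a count random variable `X` with law `X`,
the `ξᵢ` being i.i.d. Bernoulli of parameter `p` and independent of `X`: conditionally on `X = n`
it is the law of `ξ₁ + ⋯ + ξₙ`. -/
noncomputable def thinning (p : unitInterval) (X : PMF ℕ) : PMF ℕ :=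
  X.bind (bernoulliSum p)

/-- A top inverse: a count law that is not an independent `p`-thinning of any count law, for any
`p ∈ (0, 1)` (every law is its own `1`-thinning, so `p = 1` is excluded). -/
def IsTopInverse (Y : PMF ℕ) : Prop :=
  ∀ p : unitInterval, 0 < p → p < 1 → ∀ Z : PMF ℕ, Y ≠ thinning p Z

/-- Mixed Poisson law: `P (X = k) = ∫ e^{-r} r ^ k / k! dΛ(r)` for some probability measure `Λ` on
`[0, ∞)`. -/
def IsMixedPoisson (X : PMF ℕ) : Prop :=
  ∃ L : MeasureTheory.Measure NNReal, MeasureTheory.IsProbabilityMeasure L ∧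
    ∀ k : ℕ, X k = ∫⁻ r, ProbabilityTheory.poissonMeasure r {k} ∂L

/-- Probability generating function of a count law. -/
noncomputable def pgf (X : PMF ℕ) (t : ℝ) : ℝ :=
  ∑' k : ℕ, (X k).toReal * t ^ k

/-- `X` has finite expectation, equal to `μ`. -/
def HasMean (X : PMF ℕ) (μ : ℝ) : Prop :=
  HasSum (fun k : ℕ => (X k).toReal * (k : ℝ)) μ

/-- A count statistical model indexed by a set `Θ` of parameters `θ = (μ, ξ) ∈ ℝ × ℝᵐ`, whose
probability generating function `Φ(t; θ)` is jointly continuous on `(0, 1) × Θ`. The values of `law`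
outside `Θ` are irrelevant. -/
structure CountModel (m : ℕ) where
  Θ : Set (ℝ × (Fin m → ℝ))
  law : ℝ × (Fin m → ℝ) → PMF ℕ
  continuousOn_pgf :
    ContinuousOn (fun z : ℝ × (ℝ × (Fin m → ℝ)) => pgf (law z.2) z.1) (Ioo (0 : ℝ) 1 ×ˢ Θ)

namespace CountModel

variable {m : ℕ}

/-- The law `X` belongs to the model. -/
def Mem (F : CountModel m) (X : PMF ℕ) : Prop :=
  ∃ θ ∈ F.Θ, F.law θ = X

/-- The first parameter is the population mean, which is finite and positive. -/
def MeanParametrized (F : CountModel m) : Prop :=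
  ∀ θ ∈ F.Θ, 0 < θ.1 ∧ HasMean (F.law θ) θ.1

/-- Every independent `p`-thinning, `p ∈ (0, 1]`, of a member of the model is a member. -/
def ClosedUnderThinning (F : CountModel m) : Prop :=
  ∀ X : PMF ℕ, F.Mem X → ∀ p : unitInterval, 0 < p → F.Mem (thinning p X)

/-- The parameter `ξ` is invariant under independent `p`-thinning: if the member with parameter `θ'`
is a `p`-thinning of the member with parameter `θ`, both have the same `ξ`. -/
def ThinningInvariant (F : CountModel m) : Prop :=
  ∀ θ ∈ F.Θ, ∀ θ' ∈ F.Θ, ∀ p : unitInterval, 0 < p →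
    F.law θ' = thinning p (F.law θ) → θ'.2 = θ.2

/-- The parameter domain is the widest possible: a model `G` of the same kind (continuous,
parametrized by the mean and a thinning-invariant `ξ`, closed under thinning) that extends `F`,
with no values of `ξ` but those which occur in `F`, has the same parameter domain. -/
def WidestDomain (F : CountModel m) : Prop :=
  ∀ G : CountModel m, G.MeanParametrized → G.ThinningInvariant → G.ClosedUnderThinning →
    F.Θ ⊆ G.Θ → (∀ θ ∈ F.Θ, G.law θ = F.law θ) →
    (∀ θ ∈ G.Θ, ∃ θ' ∈ F.Θ, θ'.2 = θ.2) → G.Θ = F.Θ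

end CountModel

/-!
Thinning by `p` acts on generating functions by `t ↦ 1 - p + p t`. Since power series with bounded
coefficients are determined by their sum near `1` (`eq_of_pgf_eq`), thinning is injective and
`thinning p ∘ thinning q = thinning (p * q)`. In a model as in the theorem, thinning multiplies `μ`
by `p` and fixes `ξ`, so each fibre `{μ | (μ, ξ) ∈ Θ}` is an initial segment of `(0, ∞)`, and its
laws are thinnings of one another (`CountModel.mem_of_le`).

If the fibre is unbounded, its laws are `1/n`-thinnings of laws `Yₙ` for every `n`. The laws of
`Yₙ / n` have constant mean, hence are tight, and the Laplace transform of a limit point, given by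
Prokhorov's theorem, is the generating function of the member: it is mixed Poisson
(`isMixedPoisson_of_forall_thinning`).

If the fibre has supremum `b < ∞`, it is enough that the domain being widest forces two things:
`b` belongs to the fibre, and the law there is a top inverse. Otherwise there is a law `Z` of some
mean `c`, not in the fibre, which thins to all members of the fibre: in the first case a limit of
the laws with means `μ ↑ b` (no mass escapes, as the means are bounded), in the second the law of
which the member with mean `b` is a thinning. Adding the thinnings of `Z` to the fibre gives a
larger model (`CountModel.mem_of_widestDomain`). The delicate point is its joint continuity at a new
parameter that is approached by old parameters in other fibres. There the thinned laws converge by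
continuity of the given model, so the generating functions converge on an interval with right
endpoint `1`, and a compactness argument extends this to `(0, 1)` (`tendsto_pgf_of_tendsto_pgf`,
`CountModel.tendsto_pgf_law`).

The alternatives exclude each other because if a thinning of `Y` is mixed Poisson, so is `Y`, and a
mixed Poisson law is a `1/2`-thinning (`not_isTopInverse_of_isMixedPoisson_thinning`).
-/

open Filter Topology
open scoped ENNReal NNReal unitInterval

/-! ### Expectations of nonnegative functions under thinning -/

theorem PMF.tsum_bind_mul {α β : Type*} (X : PMF α) (f : α → PMF β) (g : β → ℝ≥0∞) :
    ∑' b, X.bind f b * g b = ∑' a, X a * ∑' b, f a b * g b := by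
  simp_rw [PMF.bind_apply, ← ENNReal.tsum_mul_right, ← ENNReal.tsum_mul_left]
  rw [ENNReal.tsum_comm]
  simp_rw [mul_assoc]

theorem PMF.tsum_map_mul {α β : Type*} (X : PMF α) (f : α → β) (g : β → ℝ≥0∞) :
    ∑' b, X.map f b * g b = ∑' a, X a * g (f a) := by
  rw [← PMF.bind_pure_comp, PMF.tsum_bind_mul]
  simp

theorem tsum_bernoulli_mul (p : I) (g : ℕ → ℝ≥0∞) :
    ∑' b, (ProbabilityTheory.bernoulliMeasure (1 : ℕ) 0 p).toPMF b * g b =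
      ENNReal.ofReal p * g 1 + ENNReal.ofReal (1 - p) * g 0 := by
  rw [tsum_eq_sum (s := {1, 0})]
  · rw [Finset.sum_pair one_ne_zero]
    simp only [MeasureTheory.Measure.toPMF_apply]
    rw [ProbabilityTheory.bernoulliMeasure_apply p (.singleton 1),
      ProbabilityTheory.bernoulliMeasure_apply p (.singleton 0)]
    have h (q : I) : ENNReal.ofReal q = unitInterval.toNNReal q :=
      ENNReal.ofReal_eq_coe_nnreal q.2.1
    simp [h p, ← unitInterval.coe_symm_eq, h (unitInterval.symm p)]
  · intro b hb
    simp only [Finset.mem_insert, Finset.mem_singleton, not_or] at hb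
    simp only [MeasureTheory.Measure.toPMF_apply]
    rw [ProbabilityTheory.bernoulliMeasure_apply p (.singleton b)]
    simp [Ne.symm hb.1, Ne.symm hb.2]

theorem tsum_bernoulliSum_succ_mul (p : I) (n : ℕ) (g : ℕ → ℝ≥0∞) :
    ∑' k, bernoulliSum p (n + 1) k * g k =
      ∑' k, bernoulliSum p n k *
        (ENNReal.ofReal p * g (k + 1) + ENNReal.ofReal (1 - p) * g k) := by
  simp only [bernoulliSum, PMF.tsum_bind_mul, PMF.tsum_map_mul, add_zero,
    fun s : ℕ => tsum_bernoulli_mul p fun b => g (s + b)]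

theorem tsum_bernoulliSum_mul_pow (p : I) (n : ℕ) (u : ℝ≥0∞) :
    ∑' k, bernoulliSum p n k * u ^ k =
      (ENNReal.ofReal p * u + ENNReal.ofReal (1 - p)) ^ n := by
  induction n with
  | zero => simp [bernoulliSum]
  | succ n ih =>
    rw [tsum_bernoulliSum_succ_mul, pow_succ, ← ih, ← ENNReal.tsum_mul_right]
    exact tsum_congr fun k => by ring

theorem ofReal_add_ofReal_one_sub (p : I) :
    ENNReal.ofReal p + ENNReal.ofReal (1 - p) = 1 := by
  rw [← ENNReal.ofReal_add p.2.1 (sub_nonneg.2 p.2.2)]; simp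

theorem tsum_bernoulliSum_mul_cast (p : I) (n : ℕ) :
    ∑' k, bernoulliSum p n k * (k : ℝ≥0∞) = ENNReal.ofReal p * n := by
  induction n with
  | zero => simp [bernoulliSum]
  | succ n ih =>
    rw [tsum_bernoulliSum_succ_mul]
    have (k : ℕ) : bernoulliSum p n k * (ENNReal.ofReal p * ((k + 1 : ℕ) : ℝ≥0∞) +
        ENNReal.ofReal (1 - p) * k) =
        bernoulliSum p n k * k + bernoulliSum p n k * ENNReal.ofReal p := by
      rw [← mul_add]
      congr 1
      calc _ = (ENNReal.ofReal p + ENNReal.ofReal (1 - p)) * k + ENNReal.ofReal p := by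
            push_cast; ring
        _ = _ := by rw [ofReal_add_ofReal_one_sub, one_mul]
    simp_rw [this]
    rw [ENNReal.tsum_add, ih, ENNReal.tsum_mul_right, PMF.tsum_coe]
    push_cast; ring

/-! ### Means -/

theorem hasMean_iff {X : PMF ℕ} {μ : ℝ} :
    HasMean X μ ↔ 0 ≤ μ ∧ ∑' k, X k * (k : ℝ≥0∞) = ENNReal.ofReal μ := by
  have hterm (k : ℕ) : (X k * (k : ℝ≥0∞)) = ENNReal.ofReal ((X k).toReal * k) := by
    rw [ENNReal.ofReal_mul ENNReal.toReal_nonneg, ENNReal.ofReal_toReal (X.apply_ne_top k),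
      ENNReal.ofReal_natCast]
  have hnn (k : ℕ) : 0 ≤ (X k).toReal * (k : ℝ) := by positivity
  constructor
  · intro h
    refine ⟨h.nonneg hnn, ?_⟩
    simp_rw [hterm]
    rw [← ENNReal.ofReal_tsum_of_nonneg hnn h.summable, h.tsum_eq]
  · rintro ⟨hμ, h⟩
    have h1 : ∑' k, (X k * (k : ℝ≥0∞)) ≠ ∞ := by simp [h]
    have h2 := ENNReal.hasSum_toReal h1
    rw [← ENNReal.tsum_toReal_eq fun k => ENNReal.ne_top_of_tsum_ne_top h1 k, h,
      ENNReal.toReal_ofReal hμ] at h2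
    simpa [HasMean] using h2

theorem tsum_thinning_mul_cast (p : I) (X : PMF ℕ) :
    ∑' k, thinning p X k * (k : ℝ≥0∞) = ENNReal.ofReal p * ∑' k, X k * (k : ℝ≥0∞) := by
  rw [thinning, PMF.tsum_bind_mul, ← ENNReal.tsum_mul_left]
  exact tsum_congr fun k => by rw [tsum_bernoulliSum_mul_cast]; ring

theorem HasMean.unique {X : PMF ℕ} {μ ν : ℝ} (h : HasMean X μ) (h' : HasMean X ν) : μ = ν :=
  HasSum.unique h h'

theorem HasMean.thinning {X : PMF ℕ} {μ : ℝ} (h : HasMean X μ) (p : I) :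
    HasMean (thinning p X) (p * μ) := by
  rw [hasMean_iff] at h ⊢
  exact ⟨mul_nonneg p.2.1 h.1, by
    rw [tsum_thinning_mul_cast, h.2, ENNReal.ofReal_mul p.2.1]⟩

theorem HasMean.of_thinning {X : PMF ℕ} {μ : ℝ} {p : I} (hp : 0 < p)
    (h : HasMean (_root_.thinning p X) μ) : HasMean X (μ / p) := by
  have hp' : (0 : ℝ) < p := hp
  rw [hasMean_iff] at h ⊢
  refine ⟨div_nonneg h.1 hp'.le, ?_⟩
  rw [ENNReal.ofReal_div_of_pos hp', ← h.2, tsum_thinning_mul_cast, mul_comm,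
    ENNReal.mul_div_cancel_right (by simpa using hp') ENNReal.ofReal_ne_top]

/-! ### Probability generating functions -/

theorem pgf_eq_toReal_tsum (X : PMF ℕ) {t : ℝ} (ht : 0 ≤ t) :
    pgf X t = (∑' k, X k * ENNReal.ofReal t ^ k).toReal := by
  rw [ENNReal.tsum_toReal_eq fun k =>
    ENNReal.mul_ne_top (X.apply_ne_top k) (ENNReal.pow_ne_top ENNReal.ofReal_ne_top)]
  simp [pgf, ENNReal.toReal_ofReal ht]

theorem pgf_thinning (p : I) (X : PMF ℕ) {t : ℝ} (ht : 0 ≤ t) :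
    pgf (thinning p X) t = pgf X (1 - p + p * t) := by
  have hp := p.2.1
  have hp' := sub_nonneg.2 p.2.2
  rw [pgf_eq_toReal_tsum _ ht, pgf_eq_toReal_tsum _ (by positivity), thinning,
    PMF.tsum_bind_mul]
  simp_rw [tsum_bernoulliSum_mul_pow]
  rw [add_comm (1 - (p : ℝ)), ENNReal.ofReal_add (by positivity) hp', ENNReal.ofReal_mul hp]

theorem toReal_apply_le_one (X : PMF ℕ) (k : ℕ) : (X k).toReal ≤ 1 :=
  ENNReal.toReal_le_of_le_ofReal zero_le_one (by simpa using X.coe_le_one k)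

theorem hasSum_toReal_apply (X : PMF ℕ) : HasSum (fun k => (X k).toReal) 1 := by
  have := ENNReal.hasSum_toReal (f := X) (by simp)
  rwa [← ENNReal.tsum_toReal_eq X.apply_ne_top, X.tsum_coe, ENNReal.toReal_one] at this

/-- A power series with bounded coefficients represents its sum on the open unit ball. -/
theorem hasFPowerSeriesOnBall_tsum {a : ℕ → ℝ} (ha : ∀ k, |a k| ≤ 1) :
    HasFPowerSeriesOnBall (fun s : ℝ => ∑' k, a k * s ^ k)
      (FormalMultilinearSeries.ofScalars ℝ a) 0 1 := by
  have hr : 1 ≤ (FormalMultilinearSeries.ofScalars ℝ a).radius := by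
    refine FormalMultilinearSeries.le_radius_of_bound (r := 1) _ 1 fun n => ?_
    simpa [FormalMultilinearSeries.ofScalars_norm] using ha n
  have h := (FormalMultilinearSeries.ofScalars ℝ a).hasFPowerSeriesOnBall
    (zero_lt_one.trans_le hr) |>.mono zero_lt_one hr
  convert h using 1
  ext s
  simp [FormalMultilinearSeries.sum, mul_comm]

/-- Identity theorem: bounded coefficients are determined by the sum of their power series on an
interval that accumulates at `1`. -/
theorem coeff_eq_of_tsum_eq {a b : ℕ → ℝ} (ha : ∀ k, |a k| ≤ 1) (hb : ∀ k, |b k| ≤ 1)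
    {r : ℝ} (hr : r < 1)
    (h : ∀ s ∈ Ioo r 1, ∑' k, a k * s ^ k = ∑' k, b k * s ^ k) : a = b := by
  have hA := hasFPowerSeriesOnBall_tsum ha
  have hB := hasFPowerSeriesOnBall_tsum hb
  obtain ⟨s, hs1, hs2⟩ := exists_between (max_lt hr zero_lt_one)
  have hs0 : 0 < s := (le_max_right _ _).trans_lt hs1
  have hev : (fun s : ℝ => ∑' k, a k * s ^ k) =ᶠ[𝓝 s] fun s => ∑' k, b k * s ^ k := by
    filter_upwards [Ioo_mem_nhds ((le_max_left _ _).trans_lt hs1) hs2] with x hx using h x hx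
  have heq := hA.analyticOnNhd.eqOn_of_preconnected_of_eventuallyEq hB.analyticOnNhd
    (Metric.isPreconnected_eball) (z₀ := s) (by
      rw [Metric.mem_eball, edist_dist, Real.dist_eq, sub_zero, abs_of_pos hs0]
      simpa using hs2) hev
  have hser := hA.hasFPowerSeriesAt.eq_formalMultilinearSeries_of_eventually
    hB.hasFPowerSeriesAt (heq.eventuallyEq_of_mem (Metric.eball_mem_nhds _ zero_lt_one))
  exact FormalMultilinearSeries.ofScalars_series_injective ℝ ℝ hser

/-- A count law is determined by its probability generating function on an interval with right
endpoint `1`. -/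
theorem eq_of_pgf_eq {X Y : PMF ℕ} {r : ℝ} (hr : r < 1)
    (h : ∀ s ∈ Ioo r 1, pgf X s = pgf Y s) : X = Y := by
  have hb (Z : PMF ℕ) (k : ℕ) : |(Z k).toReal| ≤ 1 := by
    rw [abs_of_nonneg ENNReal.toReal_nonneg]; exact toReal_apply_le_one Z k
  have := coeff_eq_of_tsum_eq (hb X) (hb Y) hr h
  ext k
  exact (ENNReal.toReal_eq_toReal_iff' (X.apply_ne_top k) (Y.apply_ne_top k)).1 (congrFun this k)

theorem thinning_thinning (p q : I) (X : PMF ℕ) :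
    thinning p (thinning q X) = thinning (p * q) X := by
  refine eq_of_pgf_eq zero_lt_one fun s hs => ?_
  have := mul_nonneg p.2.1 hs.1.le
  rw [pgf_thinning _ _ hs.1.le, pgf_thinning _ _ hs.1.le,
    pgf_thinning _ _ (add_nonneg (sub_nonneg.2 p.2.2) this)]
  congr 1
  push_cast
  ring

theorem thinning_one (X : PMF ℕ) : thinning 1 X = X :=
  eq_of_pgf_eq zero_lt_one fun s hs => by rw [pgf_thinning _ _ hs.1.le]; simp

theorem thinning_injective {p : I} (hp : 0 < p) : Function.Injective (thinning p) := by
  intro X Y h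
  have hp' : (0 : ℝ) < p := hp
  refine eq_of_pgf_eq (r := 1 - p) (by linarith) fun s hs => ?_
  have hs' : 0 ≤ 1 - (1 - s) / p := by
    rw [sub_nonneg, div_le_one hp']; linarith [hs.1]
  have := congrArg (pgf · (1 - (1 - s) / p)) h
  simp only [pgf_thinning _ _ hs'] at this
  convert this using 2 <;> field_simp <;> ring

/-- Bernoulli's inequality for probability generating functions. -/
theorem HasMean.one_sub_le_pgf {X : PMF ℕ} {μ : ℝ} (h : HasMean X μ) {s : ℝ} (hs : s ∈ Ioo 0 1) :
    1 - μ * (1 - s) ≤ pgf X s := by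
  have h1 : HasSum (fun k => (X k).toReal - (X k).toReal * k * (1 - s)) (1 - μ * (1 - s)) :=
    (hasSum_toReal_apply X).sub (h.mul_right _)
  have h2 : Summable fun k => (X k).toReal * s ^ k :=
    (hasSum_toReal_apply X).summable.of_nonneg_of_le (fun k => by have := hs.1; positivity)
      fun k => mul_le_of_le_one_right ENNReal.toReal_nonneg (pow_le_one₀ hs.1.le hs.2.le)
  refine hasSum_le (fun k => ?_) h1 h2.hasSum
  have := one_add_mul_le_pow (a := s - 1) (by linarith [hs.1]) k
  rw [add_sub_cancel] at this
  calc _ = (X k).toReal * (1 + k * (s - 1)) := by ring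
    _ ≤ _ := mul_le_mul_of_nonneg_left this ENNReal.toReal_nonneg

/-! ### Limits of count laws along ultrafilters -/

/-- Convergence of the coefficients implies convergence of the generating functions, also at moving
arguments, as long as these stay away from `1`. -/
theorem tendsto_pgf_of_tendsto_apply {ι : Type*} {l : Filter ι} {P : ι → PMF ℕ} {a : ℕ → ℝ}
    (ha : ∀ k, Tendsto (fun i => (P i k).toReal) l (𝓝 (a k))) {t : ι → ℝ} {s : ℝ}
    (hs : s ∈ Ioo 0 1) (ht : Tendsto t l (𝓝 s)) :
    Tendsto (fun i => pgf (P i) (t i)) l (𝓝 (∑' k, a k * s ^ k)) := by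
  obtain ⟨r, hr1, hr2⟩ := exists_between hs.2
  refine tendsto_tsum_of_dominated_convergence
    (summable_geometric_of_lt_one (hs.1.trans hr1).le hr2) (fun k => (ha k).mul (ht.pow k)) ?_
  filter_upwards [ht (Ioo_mem_nhds hs.1 hr1)] with i hi k
  have hi0 : 0 ≤ t i := hi.1.le
  rw [Real.norm_of_nonneg (by positivity)]
  exact (mul_le_of_le_one_left (by positivity) (toReal_apply_le_one _ _)).trans
    (pow_le_pow_left₀ hi0 hi.2.le k)

theorem continuousAt_pgf (X : PMF ℕ) {s : ℝ} (hs : s ∈ Ioo 0 1) : ContinuousAt (pgf X) s :=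
  tendsto_pgf_of_tendsto_apply (P := fun _ => X) (fun _ => tendsto_const_nhds) hs tendsto_id

/-- By compactness of `[0, 1]`, count laws converge coefficientwise along every ultrafilter; mass
may escape to infinity. -/
theorem exists_tendsto_apply {ι : Type*} (U : Ultrafilter ι) (P : ι → PMF ℕ) :
    ∃ a : ℕ → ℝ, (∀ k, a k ∈ Icc (0 : ℝ) 1) ∧
      ∀ k, Tendsto (fun i => (P i k).toReal) U (𝓝 (a k)) := by
  have (k : ℕ) : ∃ x ∈ Icc (0 : ℝ) 1, (U.map fun i => (P i k).toReal : Filter ℝ) ≤ 𝓝 x :=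
    isCompact_Icc.ultrafilter_le_nhds _ (by
      rw [le_principal_iff, Ultrafilter.coe_map, mem_map]
      exact univ_mem' fun i => ⟨ENNReal.toReal_nonneg, toReal_apply_le_one _ _⟩)
  choose a h1 h2 using this
  exact ⟨a, h1, h2⟩

/-- Vitali-type theorem: convergence of the generating functions on an interval with right endpoint
`1` to that of a count law implies convergence on all of `(0, 1)`, also at moving arguments. -/
theorem tendsto_pgf_of_tendsto_pgf {ι : Type*} {l : Filter ι} {P : ι → PMF ℕ} {Q : PMF ℕ} {r : ℝ}
    (hr : r < 1) (h : ∀ s ∈ Ioo r 1, Tendsto (fun i => pgf (P i) s) l (𝓝 (pgf Q s)))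
    {t : ι → ℝ} {s : ℝ} (hs : s ∈ Ioo 0 1) (ht : Tendsto t l (𝓝 s)) :
    Tendsto (fun i => pgf (P i) (t i)) l (𝓝 (pgf Q s)) := by
  rw [tendsto_iff_ultrafilter]
  intro U hU
  obtain ⟨a, ha, hlim⟩ := exists_tendsto_apply U P
  have hab : a = fun k => (Q k).toReal := by
    refine coeff_eq_of_tsum_eq (fun k => abs_le.2 ⟨by linarith [(ha k).1], (ha k).2⟩)
      (fun k => abs_le.2 ⟨by linarith [ENNReal.toReal_nonneg (a := Q k)],
        toReal_apply_le_one Q k⟩) (max_lt hr zero_lt_one) fun x hx => ?_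
    have hx0 : x ∈ Ioo 0 1 := ⟨(le_max_right _ _).trans_lt hx.1, hx.2⟩
    exact tendsto_nhds_unique (tendsto_pgf_of_tendsto_apply hlim hx0 tendsto_const_nhds)
      ((h x ⟨(le_max_left _ _).trans_lt hx.1, hx.2⟩).mono_left hU)
  have := tendsto_pgf_of_tendsto_apply hlim hs (ht.mono_left hU)
  rwa [hab] at this

/-- A coefficientwise limit of count laws with bounded means is a count law: no mass escapes. -/
theorem exists_pmf_of_tendsto_apply {ι : Type*} {l : Filter ι} [l.NeBot] {P : ι → PMF ℕ}
    {a : ℕ → ℝ} (ha : ∀ k, a k ∈ Icc (0 : ℝ) 1)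
    (hlim : ∀ k, Tendsto (fun i => (P i k).toReal) l (𝓝 (a k))) {b : ℝ}
    (hb : ∀ᶠ i in l, ∃ μ ≤ b, HasMean (P i) μ) :
    ∃ Z : PMF ℕ, ∀ k, (Z k).toReal = a k := by
  have hfin (S : Finset ℕ) : ∑ k ∈ S, a k ≤ 1 :=
    le_of_tendsto (tendsto_finsetSum S fun k _ => hlim k) (.of_forall fun i =>
      sum_le_hasSum S (fun k _ => ENNReal.toReal_nonneg) (hasSum_toReal_apply (P i)))
  have hsum : Summable a := summable_of_sum_le (fun k => (ha k).1) hfin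
  have hle : ∑' k, a k ≤ 1 := hsum.tsum_le_of_sum_le hfin
  have hge {s : ℝ} (hs : s ∈ Ioo 0 1) : 1 - b * (1 - s) ≤ ∑' k, a k := by
    have h1 : 1 - b * (1 - s) ≤ ∑' k, a k * s ^ k := by
      refine ge_of_tendsto (tendsto_pgf_of_tendsto_apply hlim hs tendsto_const_nhds) ?_
      filter_upwards [hb] with i ⟨μ, hμ, hi⟩
      have := mul_le_mul_of_nonneg_right hμ (sub_nonneg.2 hs.2.le)
      linarith [hi.one_sub_le_pgf hs]
    have hterm (k : ℕ) : a k * s ^ k ≤ a k :=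
      mul_le_of_le_one_right (ha k).1 (pow_le_one₀ hs.1.le hs.2.le)
    exact h1.trans ((hsum.of_nonneg_of_le
      (fun k => mul_nonneg (ha k).1 (pow_nonneg hs.1.le k)) hterm).tsum_le_tsum hterm hsum)
  have hone : 1 ≤ ∑' k, a k := by
    have ht : Tendsto (fun s : ℝ => 1 - b * (1 - s)) (𝓝[<] 1) (𝓝 (1 - b * (1 - 1))) :=
      Continuous.tendsto (by fun_prop) 1 |>.mono_left nhdsWithin_le_nhds
    rw [sub_self, mul_zero, sub_zero] at ht
    refine le_of_tendsto ht ?_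
    filter_upwards [Ioo_mem_nhdsLT zero_lt_one] with s hs using hge hs
  refine ⟨⟨fun k => ENNReal.ofReal (a k), ?_⟩, fun k => ENNReal.toReal_ofReal (ha k).1⟩
  have := ENNReal.ofReal_tsum_of_nonneg (fun k => (ha k).1) hsum
  rw [hle.antisymm hone, ENNReal.ofReal_one] at this
  exact this ▸ ENNReal.summable.hasSum

open MeasureTheory ProbabilityTheory

/-! ### Mixed Poisson laws -/

theorem measurable_poissonMeasure_singleton (k : ℕ) :
    Measurable fun r : ℝ≥0 => poissonMeasure r {k} := by
  simp_rw [poissonMeasure_singleton]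
  fun_prop

theorem tsum_poissonMeasure_singleton (r : ℝ≥0) : ∑' k : ℕ, poissonMeasure r {k} = 1 := by
  rw [← measure_iUnion (fun i j hij => by simpa using hij) fun k => .singleton k,
    Set.iUnion_of_singleton, measure_univ]

/-- The mixed Poisson law with mixing measure `L`. -/
noncomputable def mixedPoisson (L : Measure ℝ≥0) [IsProbabilityMeasure L] : PMF ℕ :=
  ⟨fun k => ∫⁻ r, poissonMeasure r {k} ∂L, by
    have : ∑' k, ∫⁻ r, poissonMeasure r {k} ∂L = 1 := by
      rw [← lintegral_tsum fun k => (measurable_poissonMeasure_singleton k).aemeasurable]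
      simp [tsum_poissonMeasure_singleton]
    exact this ▸ ENNReal.summable.hasSum⟩

theorem isMixedPoisson_iff {X : PMF ℕ} :
    IsMixedPoisson X ↔ ∃ (L : Measure ℝ≥0) (_ : IsProbabilityMeasure L), X = mixedPoisson L := by
  simp only [IsMixedPoisson, PMF.ext_iff]
  exact exists_congr fun L => ⟨fun ⟨h, h'⟩ => ⟨h, h'⟩, fun ⟨h, h'⟩ => ⟨h, h'⟩⟩

theorem tsum_poissonMeasure_mul_pow (r : ℝ≥0) {t : ℝ} (ht : 0 ≤ t) :
    ∑' k : ℕ, poissonMeasure r {k} * ENNReal.ofReal t ^ k =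
      ENNReal.ofReal (Real.exp (-((1 - t) * r))) := by
  have h : HasSum (fun k : ℕ => Real.exp (-r) * r ^ k / k.factorial * t ^ k)
      (Real.exp (-((1 - t) * r))) := by
    have := (NormedSpace.expSeries_div_hasSum_exp (r * t : ℝ)).mul_left (Real.exp (-r))
    rw [← Real.exp_eq_exp_ℝ, ← Real.exp_add] at this
    rw [show -((1 - t) * (r : ℝ)) = -r + r * t by ring]
    convert! this using 2 with k
    rw [mul_pow]; ring
  rw [← h.tsum_eq, ENNReal.ofReal_tsum_of_nonneg (fun k => by positivity) h.summable]
  refine tsum_congr fun k => ?_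
  rw [poissonMeasure_singleton, ENNReal.ofReal_mul (by positivity), ENNReal.ofReal_pow ht]

/-- The generating function of a mixed Poisson law at `t` is the Laplace transform of the mixing
measure at `1 - t`. -/
theorem pgf_mixedPoisson (L : Measure ℝ≥0) [IsProbabilityMeasure L] {t : ℝ} (ht : 0 ≤ t) :
    pgf (mixedPoisson L) t = ∫ r, Real.exp (-((1 - t) * (r : ℝ))) ∂L := by
  rw [pgf_eq_toReal_tsum _ ht, integral_eq_lintegral_of_nonneg_ae
    (.of_forall fun r => (Real.exp_pos _).le) (by fun_prop)]
  congr 1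
  simp_rw [← tsum_poissonMeasure_mul_pow _ ht]
  rw [lintegral_tsum fun k =>
    ((measurable_poissonMeasure_singleton k).mul_const _).aemeasurable]
  refine tsum_congr fun k => ?_
  rw [lintegral_mul_const _ (measurable_poissonMeasure_singleton k)]
  rfl

/-- If a thinning of `Y` is mixed Poisson, then `Y` is itself a thinning: with `L` the mixing
measure of the `p`-thinning, `Y` is the `1/2`-thinning of the mixed Poisson law whose mixing
measure is the image of `L` under `r ↦ 2 / p * r`. -/
theorem not_isTopInverse_of_isMixedPoisson_thinning {Y : PMF ℕ} {p : I} (hp : 0 < p)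
    (h : IsMixedPoisson (thinning p Y)) : ¬ IsTopInverse Y := by
  obtain ⟨L, hL, hX⟩ := isMixedPoisson_iff.1 h
  have hp' : (0 : ℝ) < p := hp
  have hm : Measurable fun r : ℝ≥0 => 2 / unitInterval.toNNReal p * r := by fun_prop
  have := Measure.isProbabilityMeasure_map (μ := L) hm.aemeasurable
  have h2 : (0 : ℝ) ≤ 1 / 2 ∧ (1 / 2 : ℝ) ≤ 1 := by norm_num
  refine fun htop => htop ⟨1 / 2, h2⟩ (by rw [← Subtype.coe_lt_coe]; norm_num)
    (by rw [← Subtype.coe_lt_coe]; norm_num)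
    (mixedPoisson (L.map fun r => 2 / unitInterval.toNNReal p * r)) ?_
  apply thinning_injective hp
  rw [thinning_thinning, hX]
  refine eq_of_pgf_eq zero_lt_one fun s hs => ?_
  have h3 : 0 ≤ ((p * ⟨1 / 2, h2⟩ : I) : ℝ) * s := mul_nonneg (p * ⟨1 / 2, h2⟩ : I).2.1 hs.1.le
  have h4 := (p * ⟨1 / 2, h2⟩ : I).2.2
  rw [pgf_thinning _ _ hs.1.le, pgf_mixedPoisson _ hs.1.le, pgf_mixedPoisson _ (by linarith),
    integral_map hm.aemeasurable (by fun_prop)]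
  congr 1
  ext r
  congr 1
  push_cast
  rw [unitInterval.coe_toNNReal]
  field_simp
  ring

/-! ### Laws that are `1/n`-thinnings for all `n` -/

/-- The law of `Y / n`; for `n = 0` this is the unit mass at `0`. -/
noncomputable def scaledLaw (Y : PMF ℕ) (n : ℕ) : ProbabilityMeasure ℝ≥0 :=
  ⟨Y.toMeasure.map fun k : ℕ => (k : ℝ≥0) / n,
    Measure.isProbabilityMeasure_map (by fun_prop)⟩

theorem integral_exp_scaledLaw (Y : PMF ℕ) (n : ℕ) {u : ℝ} (hu : 0 ≤ u) :
    ∫ y, Real.exp (-(u * (y : ℝ))) ∂(scaledLaw Y n : Measure ℝ≥0) =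
      pgf Y (Real.exp (-(u / n))) := by
  have hb (k : ℕ) : ‖Real.exp (-(u * ((k / n : ℝ≥0) : ℝ)))‖ ≤ 1 := by
    rw [Real.norm_of_nonneg (Real.exp_pos _).le, Real.exp_le_one_iff]
    exact neg_nonpos.2 (mul_nonneg hu (k / n : ℝ≥0).2)
  rw [scaledLaw, ProbabilityMeasure.coe_mk, integral_map (by fun_prop) (by fun_prop),
    PMF.integral_eq_tsum _ _ (.of_bound (by fun_prop) 1 (.of_forall hb))]
  refine tsum_congr fun k => ?_
  rw [smul_eq_mul, ← Real.exp_nat_mul]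
  congr 2
  push_cast
  ring

theorem scaledLaw_compl_Iic_le {Y : PMF ℕ} {n : ℕ} {μ : ℝ≥0} (hY : HasMean Y (μ * n))
    (hn : 0 < n) (N : ℕ) : scaledLaw Y n (Iic (N + 1 : ℝ≥0))ᶜ ≤ μ / (N + 1) := by
  rw [← ENNReal.coe_le_coe, ProbabilityMeasure.ennreal_coeFn_eq_coeFn_toMeasure,
    ENNReal.coe_div (by positivity)]
  have h1 : ∫⁻ y, (y : ℝ≥0∞) ∂(scaledLaw Y n : Measure ℝ≥0) = μ := by
    rw [scaledLaw, ProbabilityMeasure.coe_mk, lintegral_map (by fun_prop) (by fun_prop),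
      lintegral_countable']
    have (k : ℕ) : (((k : ℝ≥0) / n : ℝ≥0) : ℝ≥0∞) * Y.toMeasure {k} =
        Y k * (k : ℝ≥0∞) * (n : ℝ≥0∞)⁻¹ := by
      rw [PMF.toMeasure_apply_singleton _ _ (.singleton k), ENNReal.coe_div (by positivity)]
      simp [div_eq_mul_inv]; ring
    simp_rw [this]
    rw [ENNReal.tsum_mul_right, (hasMean_iff.1 hY).2]
    rw [ENNReal.ofReal_mul μ.coe_nonneg, ENNReal.ofReal_natCast, mul_assoc,
      ENNReal.mul_inv_cancel (by positivity) (by simp), mul_one]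
    simp
  rw [← h1]
  refine (measure_mono fun y hy => ?_).trans
    (meas_ge_le_lintegral_div (by fun_prop) (by simp) (by simp))
  simp only [mem_compl_iff, mem_Iic, not_le] at hy
  exact ENNReal.coe_le_coe.2 hy.le

theorem tendsto_nat_mul_one_sub_exp (u : ℝ) :
    Tendsto (fun n : ℕ => (n : ℝ) * (1 - Real.exp (-(u / n)))) atTop (𝓝 u) := by
  have h := (((hasDerivAt_id (0 : ℝ)).const_mul (-u)).exp).tendsto_slope_zero
  have h2 : Tendsto (fun n : ℕ => (n : ℝ)⁻¹) atTop (𝓝[≠] 0) :=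
    tendsto_nhdsWithin_iff.2 ⟨tendsto_inv_atTop_nhds_zero_nat, by
      filter_upwards [eventually_ge_atTop 1] with n hn
      have : (n : ℝ) ≠ 0 := by positivity
      simpa using this⟩
  have h3 := (h.comp h2).neg
  convert! h3 using 2
  · simp [div_eq_mul_inv]; ring
  · simp

/-- A count law with finite mean that is a `1/n`-thinning for every `n` is mixed Poisson: with
`Yₙ` the law it thins, `Yₙ / n` has a weak limit point, and this is a mixing measure. -/
theorem isMixedPoisson_of_forall_thinning {X : PMF ℕ} {μ : ℝ} (hX : HasMean X μ)
    (h : ∀ n : ℕ, 0 < n → ∃ (p : I) (Y : PMF ℕ), (p : ℝ) = 1 / n ∧ X = thinning p Y) :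
    IsMixedPoisson X := by
  choose! p Y hp hXY using h
  lift μ to ℝ≥0 using (hasMean_iff.1 hX).1
  have hpos {n : ℕ} (hn : 0 < n) : 0 < p n := by
    rw [← Subtype.coe_lt_coe, hp n hn]; simpa using hn
  have hmean {n : ℕ} (hn : 0 < n) : HasMean (Y n) (μ * n) := by
    have := HasMean.of_thinning (hpos hn) (hXY n hn ▸ hX)
    rwa [hp n hn, one_div, div_inv_eq_mul] at this
  have hu : Tendsto (fun N : ℕ => μ / ((N : ℝ≥0) + 1)) atTop (𝓝 0) := by
    rw [← NNReal.tendsto_coe]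
    push_cast
    exact tendsto_const_div_atTop_nhds_zero_nat (μ : ℝ) |>.comp (tendsto_add_atTop_nat 1) |>.congr
      fun N => by simp
  have hK (N : ℕ) : IsCompact (Iic ((N : ℝ≥0) + 1)) := by
    rw [← Icc_bot]; exact isCompact_Icc
  have hcomp := isCompact_setOfPred_probabilityMeasure_mass_eq_compl_isCompact_le hu hK
    (.inl inferInstance)
  set U : Ultrafilter ℕ := Ultrafilter.of atTop
  have hU : (U : Filter ℕ) ≤ atTop := Ultrafilter.of_le atTop
  obtain ⟨L, -, hL⟩ := hcomp.ultrafilter_le_nhds (U.map fun n => scaledLaw (Y n) n) (by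
    rw [le_principal_iff, Ultrafilter.coe_map, mem_map]
    filter_upwards [hU (eventually_gt_atTop 0)] with n hn N
    exact scaledLaw_compl_Iic_le (hmean hn) hn N)
  have hL' : Tendsto (fun n => scaledLaw (Y n) n) U (𝓝 L) := hL
  refine isMixedPoisson_iff.2 ⟨L, inferInstance, eq_of_pgf_eq zero_lt_one fun s hs => ?_⟩
  rw [pgf_mixedPoisson _ hs.1.le]
  have hs1 : 0 ≤ 1 - s := sub_nonneg.2 hs.2.le
  let f : BoundedContinuousFunction ℝ≥0 ℝ := .ofNormedAddCommGroup
    (fun y => Real.exp (-((1 - s) * (y : ℝ)))) (by fun_prop) 1 fun y => by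
      rw [Real.norm_of_nonneg (Real.exp_pos _).le, Real.exp_le_one_iff]
      exact neg_nonpos.2 (mul_nonneg hs1 y.2)
  have h1 := ProbabilityMeasure.tendsto_iff_forall_integral_tendsto.1 hL' f
  refine tendsto_nhds_unique ?_ h1
  -- At `1 - n (1 - exp (-(1 - s) / n))` the generating function of `X` is exactly the Laplace
  -- transform of `Yₙ / n` at `1 - s`, and this argument tends to `s`.
  have h2 : Tendsto (fun n : ℕ => 1 - (n : ℝ) * (1 - Real.exp (-((1 - s) / n)))) U (𝓝 s) := by
    have := (tendsto_nat_mul_one_sub_exp (1 - s)).const_sub 1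
    rw [sub_sub_cancel] at this
    exact this.mono_left hU
  refine ((continuousAt_pgf X hs).tendsto.comp h2).congr' ?_
  filter_upwards [hU (eventually_gt_atTop 0), h2 (Ioo_mem_nhds hs.1 hs.2)] with n hn hn2
  have hn' : (0 : ℝ) < n := by exact_mod_cast hn
  change pgf X _ = ∫ y, Real.exp (-((1 - s) * (y : ℝ))) ∂(scaledLaw (Y n) n : Measure ℝ≥0)
  rw [integral_exp_scaledLaw _ _ hs1]
  conv_lhs => rw [hXY n hn]
  rw [pgf_thinning _ _ hn2.1.le, hp n hn]
  congr 1
  field_simp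
  ring

/-! ### Thinning inside a model -/

/-- The quotient `a / b`, truncated to the unit interval: the factor that thins mean `b` to mean `a`
if `0 < a ≤ b`. -/
noncomputable def ratio (a b : ℝ) : I := projIcc 0 1 zero_le_one (a / b)

theorem coe_ratio {a b : ℝ} (ha : 0 < a) (hab : a ≤ b) : (ratio a b : ℝ) = a / b := by
  rw [ratio, projIcc_of_mem zero_le_one
    ⟨div_nonneg ha.le (ha.le.trans hab), div_le_one_of_le₀ hab (ha.le.trans hab)⟩]

theorem ratio_pos {a b : ℝ} (ha : 0 < a) (hab : a ≤ b) : 0 < ratio a b := by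
  rw [← Subtype.coe_lt_coe, coe_ratio ha hab]
  exact div_pos ha (ha.trans_le hab)

theorem ratio_mul_ratio {a b c : ℝ} (ha : 0 < a) (hab : a ≤ b) (hbc : b ≤ c) :
    ratio a b * ratio b c = ratio a c := by
  have hb := ha.trans_le hab
  rw [← Subtype.coe_inj]
  push_cast
  rw [coe_ratio ha hab, coe_ratio hb hbc, coe_ratio ha (hab.trans hbc)]
  field_simp

theorem mul_ratio (p : I) (hp : 0 < p) {a b : ℝ} (ha : 0 < a) (hab : a ≤ b) :
    p * ratio a b = ratio (p * a) b := by
  have hpa : 0 < p * a := mul_pos hp ha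
  rw [← Subtype.coe_inj]
  push_cast
  rw [coe_ratio ha hab, coe_ratio hpa ((mul_le_of_le_one_left ha.le p.2.2).trans hab),
    mul_div_assoc]

namespace CountModel

variable {m : ℕ} {F : CountModel m}

/-- In a model parametrized by the mean and a thinning-invariant `ξ`, thinning acts on the
parameters by scaling the mean. -/
theorem thinning_mem (hmean : F.MeanParametrized) (hξ : F.ThinningInvariant)
    (hclosed : F.ClosedUnderThinning) {μ : ℝ} {ξ : Fin m → ℝ} (h : (μ, ξ) ∈ F.Θ)
    {p : I} (hp : 0 < p) :
    (p * μ, ξ) ∈ F.Θ ∧ F.law (p * μ, ξ) = thinning p (F.law (μ, ξ)) := by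
  obtain ⟨⟨μ', ξ'⟩, hθ', hlaw⟩ := hclosed _ ⟨_, h, rfl⟩ p hp
  obtain rfl : ξ' = ξ := hξ _ h _ hθ' p hp hlaw
  obtain rfl : μ' = p * μ :=
    (hmean _ hθ').2.unique (hlaw ▸ (hmean _ h).2.thinning p)
  exact ⟨hθ', hlaw⟩

theorem mem_of_le (hmean : F.MeanParametrized) (hξ : F.ThinningInvariant)
    (hclosed : F.ClosedUnderThinning) {μ ν : ℝ} {ξ : Fin m → ℝ} (h : (μ, ξ) ∈ F.Θ)
    (hν : 0 < ν) (hνμ : ν ≤ μ) :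
    (ν, ξ) ∈ F.Θ ∧ F.law (ν, ξ) = thinning (ratio ν μ) (F.law (μ, ξ)) := by
  have := thinning_mem hmean hξ hclosed h (ratio_pos hν hνμ)
  rwa [coe_ratio hν hνμ, div_mul_cancel₀ _ (hν.trans_le hνμ).ne'] at this

/-- The generating functions of the members of a model with parameters near `(μ, ξ)` converge to
that of `P`, as soon as `P` thins to a member of the model with parameter `ξ`; the point `(μ, ξ)`
need not belong to the domain. The thinned laws converge by continuity of the model, which gives
convergence of the generating functions near `1`, hence on `(0, 1)`. -/
theorem tendsto_pgf_law (hmean : F.MeanParametrized) (hξ : F.ThinningInvariant)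
    (hclosed : F.ClosedUnderThinning) {μ ν : ℝ} {ξ : Fin m → ℝ} (hν : (ν, ξ) ∈ F.Θ)
    (hνμ : ν < μ) {P : PMF ℕ} (hP : F.law (ν, ξ) = thinning (ratio ν μ) P) {t : ℝ}
    (ht : t ∈ Ioo 0 1) :
    Tendsto (fun z : ℝ × (ℝ × (Fin m → ℝ)) => pgf (F.law z.2) z.1)
      (𝓝[Ioo (0 : ℝ) 1 ×ˢ F.Θ] (t, (μ, ξ))) (𝓝 (pgf P t)) := by
  have hν0 : 0 < ν := (hmean _ hν).1
  have hμ0 : 0 < μ := hν0.trans hνμ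
  set l := 𝓝[Ioo (0 : ℝ) 1 ×ˢ F.Θ] (t, (μ, ξ))
  have hl : l ≤ 𝓝 (t, (μ, ξ)) := nhdsWithin_le_nhds
  have hfst : Tendsto (fun z : ℝ × (ℝ × (Fin m → ℝ)) => z.1) l (𝓝 t) :=
    (continuous_fst.tendsto _).mono_left hl
  have hmu : Tendsto (fun z : ℝ × (ℝ × (Fin m → ℝ)) => z.2.1) l (𝓝 μ) :=
    (Continuous.tendsto (by fun_prop) (t, (μ, ξ))).mono_left hl
  have hxi : Tendsto (fun z : ℝ × (ℝ × (Fin m → ℝ)) => z.2.2) l (𝓝 ξ) :=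
    (Continuous.tendsto (by fun_prop) (t, (μ, ξ))).mono_left hl
  refine tendsto_pgf_of_tendsto_pgf (r := 1 - ν / μ) (by have := div_pos hν0 hμ0; linarith)
    (fun s hs => ?_) ht hfst
  -- `u y` is the point which `t ↦ 1 - p + p t` maps to `s` for the factor `p = ν / y` that thins
  -- mean `y` to mean `ν`.
  let u (y : ℝ) : ℝ := 1 - (1 - s) * y / ν
  have hu : u μ ∈ Ioo 0 1 := by
    have h1 : 1 - s < ν / μ := by linarith [hs.1]
    rw [lt_div_iff₀ hμ0] at h1
    have h2 : 0 < (1 - s) * μ / ν := div_pos (mul_pos (by linarith [hs.2]) hμ0) hν0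
    have h3 : (1 - s) * μ / ν < 1 := (div_lt_one hν0).2 h1
    exact ⟨by simp only [u]; linarith, by simp only [u]; linarith⟩
  have hulim : Tendsto (fun z : ℝ × (ℝ × (Fin m → ℝ)) => u z.2.1) l (𝓝 (u μ)) :=
    (show Continuous u by fun_prop).continuousAt.tendsto.comp hmu
  have hu_eq {y : ℝ} (hy : ν ≤ y) : 1 - (ratio ν y : ℝ) + ratio ν y * u y = s := by
    have := hν0.trans_le hy
    rw [coe_ratio hν0 hy]
    simp only [u]
    field_simp
    ring
  have hval : pgf P s = pgf (F.law (ν, ξ)) (u μ) := by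
    rw [hP, pgf_thinning _ _ hu.1.le, hu_eq hνμ.le]
  have hev : ∀ᶠ z in l, z.2.1 ∈ Ioi ν ∧ u z.2.1 ∈ Ioo 0 1 ∧ z.2 ∈ F.Θ := by
    filter_upwards [hmu (Ioi_mem_nhds hνμ), hulim (Ioo_mem_nhds hu.1 hu.2),
      self_mem_nhdsWithin] with z h1 h2 h3 using ⟨h1, h2, h3.2⟩
  have hmem {z : ℝ × (ℝ × (Fin m → ℝ))} (h1 : z.2.1 ∈ Ioi ν) (h3 : z.2 ∈ F.Θ) :=
    mem_of_le hmean hξ hclosed (μ := z.2.1) (ξ := z.2.2) h3 hν0 (le_of_lt h1)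
  rw [hval]
  have hcont := F.continuousOn_pgf (u μ, (ν, ξ)) ⟨hu, hν⟩
  have hlim : Tendsto (fun z : ℝ × (ℝ × (Fin m → ℝ)) => (u z.2.1, (ν, z.2.2))) l
      (𝓝[Ioo (0 : ℝ) 1 ×ˢ F.Θ] (u μ, (ν, ξ))) := by
    refine tendsto_nhdsWithin_iff.2
      ⟨hulim.prodMk_nhds (tendsto_const_nhds.prodMk_nhds hxi), ?_⟩
    filter_upwards [hev] with z ⟨h1, h2, h3⟩ using ⟨h2, (hmem h1 h3).1⟩
  refine (hcont.tendsto.comp hlim).congr' ?_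
  filter_upwards [hev] with z ⟨h1, h2, h3⟩
  simp only [Function.comp_apply]
  rw [(hmem h1 h3).2, pgf_thinning _ _ h2.1.le, hu_eq (le_of_lt h1)]

/-! ### Extending a model in one fibre -/

/-- Thinnings of `Z` and of a member with parameter `ξ'` can agree only if `ξ'` is the parameter of
the members that `Z` thins to. -/
theorem snd_eq_of_thinning_eq (hmean : F.MeanParametrized) (hξ : F.ThinningInvariant)
    (hclosed : F.ClosedUnderThinning) {μ c : ℝ} {ξ : Fin m → ℝ} (hμ : (μ, ξ) ∈ F.Θ) {Z : PMF ℕ}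
    (hZ : ∀ ν, (ν, ξ) ∈ F.Θ → ν ≤ c ∧ F.law (ν, ξ) = thinning (ratio ν c) Z)
    {θ : ℝ × (Fin m → ℝ)} (hθ : θ ∈ F.Θ) {p q : I} (hp : 0 < p) (hq : 0 < q)
    (h : thinning p (F.law θ) = thinning q Z) : θ.2 = ξ := by
  have hμ0 : 0 < μ := (hmean _ hμ).1
  have hμc : μ ≤ c := (hZ μ hμ).1
  have hs : 0 < ratio μ c := ratio_pos hμ0 hμc
  have hsq : (ratio μ c : ℝ) * q * c ≤ μ := by
    rw [coe_ratio hμ0 hμc, mul_right_comm, div_mul_cancel₀ _ (hμ0.trans_le hμc).ne']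
    exact mul_le_of_le_one_right hμ0.le q.2.2
  have hpos : 0 < (ratio μ c : ℝ) * q * c := mul_pos (mul_pos hs hq) (hμ0.trans_le hμc)
  obtain ⟨h1, -⟩ := mem_of_le hmean hξ hclosed hμ hpos hsq
  obtain ⟨ν, ξ'⟩ := θ
  obtain ⟨h2, h3⟩ := thinning_mem hmean hξ hclosed hθ (mul_pos hs hp : 0 < ratio μ c * p)
  have hsnd := hξ _ h1 _ h2 1 one_pos
  refine hsnd ?_
  rw [thinning_one, h3, (hZ _ h1).2, ← thinning_thinning, h, thinning_thinning]
  congr 1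
  rw [← Subtype.coe_inj, coe_ratio hpos (hsq.trans hμc), mul_div_cancel_right₀ _
    (hμ0.trans_le hμc).ne']
  rfl

open Classical in
/-- The extension of a model in the fibre over `ξ` by the thinnings of a law `Z` with mean `c`. -/
noncomputable def extend (F : CountModel m) (hmean : F.MeanParametrized)
    (hξ : F.ThinningInvariant) (hclosed : F.ClosedUnderThinning) {μ c : ℝ} {ξ : Fin m → ℝ}
    (hμ : (μ, ξ) ∈ F.Θ) {Z : PMF ℕ}
    (hZ : ∀ ν, (ν, ξ) ∈ F.Θ → ν ≤ c ∧ F.law (ν, ξ) = thinning (ratio ν c) Z) : CountModel m where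
  Θ := F.Θ ∪ Ioc 0 c ×ˢ {ξ}
  law θ := if θ.2 = ξ then thinning (ratio θ.1 c) Z else F.law θ
  continuousOn_pgf := by
    have hc : μ ≤ c := (hZ μ hμ).1
    have hfib : ContinuousOn (fun z : ℝ × (ℝ × (Fin m → ℝ)) =>
        pgf (if z.2.2 = ξ then thinning (ratio z.2.1 c) Z else F.law z.2) z.1)
        (Ioo (0 : ℝ) 1 ×ˢ Ioc 0 c ×ˢ {ξ}) := by
      have : ContinuousOn (fun z : ℝ × (ℝ × (Fin m → ℝ)) => pgf Z (1 - z.2.1 / c * (1 - z.1)))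
          (Ioo (0 : ℝ) 1 ×ˢ Ioc 0 c ×ˢ {ξ}) := by
        rintro ⟨t, ν, ξ'⟩ ⟨ht, hν, -⟩
        have h1 : 0 < ν / c := div_pos hν.1 (hν.1.trans_le hν.2)
        have h2 : ν / c ≤ 1 := div_le_one_of_le₀ hν.2 (hν.1.le.trans hν.2)
        have h3 : 0 < 1 - t := sub_pos.2 ht.2
        have h4 : ν / c * (1 - t) ≤ 1 * (1 - t) := mul_le_mul_of_nonneg_right h2 h3.le
        have h5 := mul_pos h1 h3
        refine (ContinuousAt.comp' (g := pgf Z) (continuousAt_pgf Z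
          ⟨by have := ht.1; simp only; linarith, by simp only; linarith⟩)
          (by fun_prop)).continuousWithinAt
      refine this.congr ?_
      rintro ⟨t, ν, ξ'⟩ ⟨ht, hν, rfl⟩
      simp only [if_true]
      rw [pgf_thinning _ _ ht.1.le, coe_ratio hν.1 hν.2]
      congr 1
      ring
    have hlaw {θ : ℝ × (Fin m → ℝ)} (hθ : θ ∈ F.Θ) :
        (if θ.2 = ξ then thinning (ratio θ.1 c) Z else F.law θ) = F.law θ := by
      split_ifs with h
      · obtain ⟨ν, ξ'⟩ := θ
        obtain rfl : ξ' = ξ := h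
        exact (hZ ν hθ).2.symm
      · rfl
    rw [prod_union]
    intro z hz
    refine continuousWithinAt_union.2 ⟨?_, ?_⟩
    · by_cases hzF : z.2 ∈ F.Θ
      · exact (F.continuousOn_pgf.congr fun z' hz' => by rw [hlaw hz'.2]) z ⟨by
          rcases hz with hz | hz <;> exact hz.1, hzF⟩
      · obtain ⟨t, ν, ξ'⟩ := z
        obtain ⟨ht, hν, rfl⟩ : t ∈ Ioo (0 : ℝ) 1 ∧ ν ∈ Ioc 0 c ∧ ξ' = ξ := by
          rcases hz with hz | hz
          · exact absurd hz.2 hzF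
          · exact ⟨hz.1, hz.2.1, hz.2.2⟩
        have hμν : μ < ν := by
          by_contra! h
          exact hzF (mem_of_le hmean hξ hclosed hμ hν.1 h).1
        have := tendsto_pgf_law hmean hξ hclosed hμ hμν (P := thinning (ratio ν c) Z) (by
          rw [thinning_thinning, ratio_mul_ratio (hmean _ hμ).1 hμν.le hν.2]
          exact (hZ μ hμ).2) ht
        simp only [ContinuousWithinAt, if_true]
        refine this.congr' ?_
        filter_upwards [self_mem_nhdsWithin] with z' hz'
        rw [hlaw hz'.2]
    · by_cases hzξ : z.2.2 = ξ
      · refine hfib z ?_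
        rcases hz with hz | hz
        · refine ⟨hz.1, ⟨(hmean _ hz.2).1, ?_⟩, hzξ⟩
          obtain ⟨t, ν, ξ'⟩ := z
          obtain rfl : ξ' = ξ := hzξ
          exact (hZ ν hz.2).1
        · exact hz
      · refine continuousWithinAt_of_notMem_closure fun h => hzξ ?_
        have hcl : IsClosed {z : ℝ × (ℝ × (Fin m → ℝ)) | z.2.2 = ξ} :=
          isClosed_eq (by fun_prop) continuous_const
        exact closure_minimal (fun z' hz' => hz'.2.2) hcl h

/-- A widest model contains every law that thins to all members of a fibre. -/
theorem mem_of_widestDomain (hmean : F.MeanParametrized)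
    (hξ : F.ThinningInvariant) (hclosed : F.ClosedUnderThinning) (hwide : F.WidestDomain)
    {μ c : ℝ} {ξ : Fin m → ℝ}
    (hμ : (μ, ξ) ∈ F.Θ) {Z : PMF ℕ} (hZc : HasMean Z c)
    (hZ : ∀ ν, (ν, ξ) ∈ F.Θ → ν ≤ c ∧ F.law (ν, ξ) = thinning (ratio ν c) Z) :
    (c, ξ) ∈ F.Θ := by
  have hμ0 : 0 < μ := (hmean _ hμ).1
  have hc0 : 0 < c := hμ0.trans_le (hZ μ hμ).1
  let G := F.extend hmean hξ hclosed hμ hZ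
  have hfib {ν : ℝ} : (ν, ξ) ∈ G.Θ ↔ ν ∈ Ioc 0 c :=
    ⟨fun h => h.elim (fun h => ⟨(hmean _ h).1, (hZ ν h).1⟩) fun h => h.1,
      fun h => .inr ⟨h, rfl⟩⟩
  have hoff {θ : ℝ × (Fin m → ℝ)} (hθ : θ.2 ≠ ξ) : θ ∈ G.Θ ↔ θ ∈ F.Θ :=
    ⟨fun h => h.resolve_right fun h' => hθ h'.2, .inl⟩
  have hlaw_fib (ν : ℝ) : G.law (ν, ξ) = thinning (ratio ν c) Z := if_pos rfl
  have hlaw_off {ν : ℝ} {ξ' : Fin m → ℝ} (h : ξ' ≠ ξ) : G.law (ν, ξ') = F.law (ν, ξ') := if_neg h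
  have hlaw {θ : ℝ × (Fin m → ℝ)} (hθ : θ ∈ F.Θ) : G.law θ = F.law θ := by
    obtain ⟨ν, ξ'⟩ := θ
    rcases eq_or_ne ξ' ξ with rfl | h
    · rw [hlaw_fib, (hZ ν hθ).2]
    · exact hlaw_off h
  have hGmean : G.MeanParametrized := by
    rintro ⟨ν, ξ'⟩ hθ
    rcases eq_or_ne ξ' ξ with rfl | h
    · have hν := hfib.1 hθ
      refine ⟨hν.1, ?_⟩
      have := hZc.thinning (ratio ν c)
      rwa [coe_ratio hν.1 hν.2, div_mul_cancel₀ _ hc0.ne', ← hlaw_fib] at this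
    · rw [hlaw_off h]
      exact hmean _ ((hoff h).1 hθ)
  have hGinv : G.ThinningInvariant := by
    rintro ⟨ν, ξ₁⟩ hθ ⟨ν', ξ₂⟩ hθ' p hp heq
    rcases eq_or_ne ξ₁ ξ with rfl | h1
    · rcases eq_or_ne ξ₂ ξ₁ with rfl | h2
      · rfl
      · have hν := hfib.1 hθ
        rw [hlaw_off h2, hlaw_fib, thinning_thinning] at heq
        refine snd_eq_of_thinning_eq hmean hξ hclosed hμ hZ ((hoff h2).1 hθ') one_pos
          (mul_pos hp (ratio_pos hν.1 hν.2)) ?_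
        rw [thinning_one, heq]
    · rcases eq_or_ne ξ₂ ξ with rfl | h3
      · have hν := hfib.1 hθ'
        rw [hlaw_off h1, hlaw_fib] at heq
        exact (snd_eq_of_thinning_eq hmean hξ hclosed hμ hZ ((hoff h1).1 hθ) hp
          (ratio_pos hν.1 hν.2) heq.symm).symm
      · rw [hlaw_off h1, hlaw_off h3] at heq
        exact hξ _ ((hoff h1).1 hθ) _ ((hoff h3).1 hθ') p hp heq
  have hGclosed : G.ClosedUnderThinning := by
    rintro X ⟨⟨ν, ξ'⟩, hθ, rfl⟩ p hp
    rcases eq_or_ne ξ' ξ with rfl | h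
    · have hν := hfib.1 hθ
      have hpν : (p : ℝ) * ν ∈ Ioc 0 c :=
        ⟨mul_pos hp hν.1, (mul_le_of_le_one_left hν.1.le p.2.2).trans hν.2⟩
      refine ⟨(p * ν, ξ'), hfib.2 hpν, ?_⟩
      rw [hlaw_fib, hlaw_fib, thinning_thinning, mul_ratio p hp hν.1 hν.2]
    · obtain ⟨h1, h2⟩ := thinning_mem hmean hξ hclosed ((hoff h).1 hθ) hp
      exact ⟨_, .inl h1, by rw [hlaw h1, h2, hlaw_off h]⟩
  rw [← hwide G hGmean hGinv hGclosed subset_union_left (fun θ hθ => hlaw hθ) ?_]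
  · exact hfib.2 ⟨hc0, le_rfl⟩
  · rintro θ (hθ | hθ)
    · exact ⟨θ, hθ, rfl⟩
    · exact ⟨_, hμ, hθ.2.symm⟩

/-! ### The fibres of a widest model -/

/-- The laws of a fibre that contains `(0, b)` have a limit point as their mean increases to `b`: a
law with mean `b`, of which they are thinnings. -/
theorem exists_limit_law (hmean : F.MeanParametrized) (hξ : F.ThinningInvariant)
    (hclosed : F.ClosedUnderThinning) {b : ℝ} {ξ : Fin m → ℝ} (hb : 0 < b)
    (hfib : ∀ ν ∈ Ioo 0 b, (ν, ξ) ∈ F.Θ) :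
    ∃ Z : PMF ℕ, HasMean Z b ∧ ∀ ν ∈ Ioo 0 b, F.law (ν, ξ) = thinning (ratio ν b) Z := by
  set U : Ultrafilter ℝ := Ultrafilter.of (𝓝[<] b)
  have hU : (U : Filter ℝ) ≤ 𝓝[<] b := Ultrafilter.of_le _
  have hUid : Tendsto (fun y : ℝ => y) U (𝓝 b) := hU.trans nhdsWithin_le_nhds
  obtain ⟨a, ha, hlim⟩ := exists_tendsto_apply U fun y => F.law (y, ξ)
  obtain ⟨Z, hZ⟩ := exists_pmf_of_tendsto_apply ha hlim (b := b) (by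
    filter_upwards [hU (Ioo_mem_nhdsLT hb)] with y hy using ⟨y, hy.2.le, (hmean _ (hfib y hy)).2⟩)
  have hlaw : ∀ ν ∈ Ioo 0 b, F.law (ν, ξ) = thinning (ratio ν b) Z := by
    intro ν hν
    refine eq_of_pgf_eq zero_lt_one fun s hs => ?_
    have h1 : 0 < ν / b := div_pos hν.1 hb
    have h2 : ν / b < 1 := (div_lt_one hb).2 hν.2
    have harg : Tendsto (fun y : ℝ => 1 - ν / y + ν / y * s) U
        (𝓝 (1 - ν / b + ν / b * s)) := by
      have : Tendsto (fun y : ℝ => ν / y) U (𝓝 (ν / b)) := tendsto_const_nhds.div hUid hb.ne'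
      exact (this.const_sub 1).add (this.mul_const s)
    have hmem : 1 - ν / b + ν / b * s ∈ Ioo 0 1 := by
      have := mul_pos h1 hs.1
      have := mul_pos h1 (sub_pos.2 hs.2)
      constructor <;> linarith
    have := tendsto_pgf_of_tendsto_apply hlim hmem harg
    rw [pgf_thinning _ _ hs.1.le, coe_ratio hν.1 hν.2.le]
    simp_rw [← hZ] at this
    refine tendsto_nhds_unique (tendsto_const_nhds.congr' ?_) this
    filter_upwards [hU (Ioo_mem_nhdsLT hν.2)] with y hy
    rw [(mem_of_le hmean hξ hclosed (hfib y ⟨hν.1.trans hy.1, hy.2⟩) hν.1 hy.1.le).2,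
      pgf_thinning _ _ hs.1.le, coe_ratio hν.1 hy.1.le]
  refine ⟨Z, ?_, hlaw⟩
  have hhalf : b / 2 ∈ Ioo 0 b := ⟨by positivity, by linarith⟩
  have h1 := (hmean _ (hfib _ hhalf)).2
  rw [hlaw _ hhalf] at h1
  have h2 := h1.of_thinning (ratio_pos hhalf.1 hhalf.2.le)
  rw [coe_ratio hhalf.1 hhalf.2.le] at h2
  convert h2 using 1
  field_simp

/-- If the means of a fibre are bounded, the fibre has a member of largest mean, and it is a top
inverse. -/
theorem exists_isTopInverse (hmean : F.MeanParametrized) (hξ : F.ThinningInvariant)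
    (hclosed : F.ClosedUnderThinning) (hwide : F.WidestDomain) {μ : ℝ} {ξ : Fin m → ℝ}
    (hμ : (μ, ξ) ∈ F.Θ) (hbdd : BddAbove {ν | (ν, ξ) ∈ F.Θ}) :
    ∃ b, (b, ξ) ∈ F.Θ ∧ μ ≤ b ∧ IsTopInverse (F.law (b, ξ)) := by
  set S : Set ℝ := {ν | (ν, ξ) ∈ F.Θ} with hS
  set b := sSup S
  have hle {ν : ℝ} (hν : (ν, ξ) ∈ F.Θ) : ν ≤ b := le_csSup hbdd hν
  have hb : 0 < b := (hmean _ hμ).1.trans_le (hle hμ)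
  have hlt : ∀ ν ∈ Ioo 0 b, (ν, ξ) ∈ F.Θ := fun ν hν => by
    obtain ⟨y, hy, hνy⟩ := exists_lt_of_lt_csSup ⟨μ, hμ⟩ hν.2
    exact (mem_of_le hmean hξ hclosed hy hν.1 hνy.le).1
  have hbmem : (b, ξ) ∈ F.Θ := by
    by_contra hbn
    obtain ⟨Z, hZb, hZ⟩ := exists_limit_law hmean hξ hclosed hb hlt
    exact hbn (mem_of_widestDomain hmean hξ hclosed hwide hμ hZb fun ν hν => ⟨hle hν,
      hZ ν ⟨(hmean _ hν).1, (hle hν).lt_of_ne fun h => hbn (h ▸ hν)⟩⟩)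
  refine ⟨b, hbmem, hle hμ, fun p hp hp1 Z hZ => ?_⟩
  have hp0 : (0 : ℝ) < p := hp
  have hp1' : (p : ℝ) < 1 := hp1
  have hlt' : b < b / p := (lt_div_iff₀ hp0).2 (mul_lt_of_lt_one_right hb hp1')
  have hpr : ratio b (b / p) = p := by
    rw [← Subtype.coe_inj, coe_ratio hb hlt'.le, div_div_cancel₀ hb.ne']
  refine hlt'.not_ge (hle (mem_of_widestDomain hmean hξ hclosed hwide hμ
    (HasMean.of_thinning hp (hZ ▸ (hmean _ hbmem).2)) fun ν hν => ⟨(hle hν).trans hlt'.le, ?_⟩))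
  have hν0 : 0 < ν := (hmean _ hν).1
  rw [(mem_of_le hmean hξ hclosed hbmem hν0 (hle hν)).2, hZ, thinning_thinning,
    ← ratio_mul_ratio hν0 (hle hν) hlt'.le, hpr]

/-- If the means of a fibre are unbounded, its members are `1/n`-thinnings for all `n`. -/
theorem isMixedPoisson_of_not_bddAbove (hmean : F.MeanParametrized) (hξ : F.ThinningInvariant)
    (hclosed : F.ClosedUnderThinning) {μ : ℝ} {ξ : Fin m → ℝ}
    (hμ : (μ, ξ) ∈ F.Θ) (hbdd : ¬ BddAbove {ν | (ν, ξ) ∈ F.Θ}) :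
    IsMixedPoisson (F.law (μ, ξ)) := by
  have hμ0 : 0 < μ := (hmean _ hμ).1
  refine isMixedPoisson_of_forall_thinning (hmean _ hμ).2 fun n hn => ?_
  have hn1 : (1 : ℝ) ≤ n := by exact_mod_cast hn
  have hle : μ ≤ n * μ := le_mul_of_one_le_left hμ0.le hn1
  obtain ⟨M, hM, hlt⟩ := not_bddAbove_iff.1 hbdd (n * μ)
  have h1 := (mem_of_le hmean hξ hclosed hM (hμ0.trans_le hle) hlt.le).1
  refine ⟨ratio μ (n * μ), _, ?_, (mem_of_le hmean hξ hclosed h1 hμ0 hle).2⟩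
  rw [coe_ratio hμ0 hle]
  field_simp

end CountModel

/-! ### The dichotomy -/

theorem proposition2 {m : ℕ} (F : CountModel m)
    (hmean : F.MeanParametrized) (hξ : F.ThinningInvariant)
    (hclosed : F.ClosedUnderThinning) (hwide : F.WidestDomain)
    (X : PMF ℕ) (hX : F.Mem X) :
    (IsMixedPoisson X ∨
      ∃ Y : PMF ℕ, F.Mem Y ∧ IsTopInverse Y ∧ ∃ p : unitInterval, 0 < p ∧ X = thinning p Y) ∧
    ¬ (IsMixedPoisson X ∧
      ∃ Y : PMF ℕ, F.Mem Y ∧ IsTopInverse Y ∧ ∃ p : unitInterval, 0 < p ∧ X = thinning p Y) := by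
  constructor
  · obtain ⟨⟨μ, ξ⟩, hμ, rfl⟩ := hX
    by_cases hbdd : BddAbove {ν | (ν, ξ) ∈ F.Θ}
    · obtain ⟨b, hb, hμb, htop⟩ :=
        CountModel.exists_isTopInverse hmean hξ hclosed hwide hμ hbdd
      have hμ0 := (hmean _ hμ).1
      exact .inr ⟨_, ⟨_, hb, rfl⟩, htop, ratio μ b, ratio_pos hμ0 hμb,
        (CountModel.mem_of_le hmean hξ hclosed hb hμ0 hμb).2⟩
    · exact .inl (CountModel.isMixedPoisson_of_not_bddAbove hmean hξ hclosed hμ hbdd)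
  · rintro ⟨hmix, Y, -, htop, p, hp, rfl⟩
    exact not_isTopInverse_of_isMixedPoisson_thinning hp hmix htop
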